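/- Work on $[0,\infty)$ with Lebesgue measure $\lambda$. Let $M$ be the set of measurable extended complex-valued functions on $[0,\infty)$ (functions equal a.e. being identified), and $M_+$ the set of measurable functions with values in $[0,\infty]$. For $f\in M$ let $\lambda_f(s)=\lambda(\{|f|>s\})$ for $s\ge 0$ be its distribution function and $f^*(t)=\inf\{s\in[0,\infty):\lambda_f(s)\le t\}$ for $t\ge0$ its non-increasing rearrangement. A functional $\|\cdot\|:M\to[0,\infty]$ with $\|\,|f|\,\|=\|f\|$ for all $f\in M$ is a *Banach function norm* if on $M_+$ it satisfies - (P1) $\|af\|=|a|\|f\|$ for $a\in\mathbb C$; $\|f\|=0$ iff $f=0$ a.e.; $\|f+g\|\le\|f\|+\|g\|$; - (P2) $f\le g$ a.e. implies $\|f\|\le\|g\|$; - (P3) $f_n\uparrow f$ a.e. implies $\|f_n\|\uparrow\|f\|$; - (P4) $\|\chi_E\|<\infty$ whenever $\lambda(E)<\infty$; - (P5) whenever $\lambda(E)<\infty$ there is a finite constant $C_E$ such that $\int_E f\,d\lambda\le C_E\|f\|$ for all $f\in M_+$. It is a *quasi-Banach function norm* if on $M_+$ it satisfies (P2), (P3),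 (P4) and (P1) with the triangle inequality weakened to $\|f+g\|\le C(\|f\|+\|g\|)$ for some constant $C\ge1$. It is *rearrangement-invariant* (r.i.) if $\|f\|=\|g\|$ whenever $\lambda_f=\lambda_g$. Two functionals $N_1,N_2$ on $M$ are *equivalent* if there is $C\in(0,\infty)$ with $C^{-1}N_1(f)\le N_2(f)\le C\,N_1(f)$ for all $f\in M$. For $p,q\in[1,\infty]$ and $f\in M$ let $$\|f\|_{W(L^p,l^q)}=\Big(\sum_{n=0}^\infty\|f\chi_{[n,n+1)}\|_{L^p}^q\Big)^{1/q}\ (q<\infty),\qquad \|f\|_{W(L^p,l^\infty)}=\sup_{n\in\mathbb N}\|f\chi_{[n,n+1)}\|_{L^p},$$ $$\|f\|_{WL(L^p,L^q)}=\|f^*\chi_{[0,1]}\|_{L^p}+\|f^*\chi_{(1,\infty)}\|_{L^q}.$$ **Statement.** Let $p,q\in[1,\infty]$. 1. The functional $f\mapsto\|f^*\|_{W(L^p,l^q)}$ is an r.i. quasi-Banach function norm, and it is equivalent to $\|\cdot\|_{WL(L^p,L^q)}$. 2. If $q<p$, then $\|\cdot\|_{W(L^p,l^q)}$ does not satisfy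 (P4). If $p<q$, then $\|\cdot\|_{W(L^p,l^q)}$ does not satisfy (P5). Consequently $\|\cdot\|_{W(L^p,l^q)}$ is a Banach function norm if and only if $p=q$. 3. $\|\cdot\|_{W(L^p,l^q)}$ is equivalent to a rearrangement-invariant norm if and only if $p=q$. This holds both when "norm" means a functional $M\to[0,\infty]$ with $\|\,|f|\,\|=\|f\|$ that satisfies (P1), and when it means a Banach function norm. 4. If $p=q$, then $\|f\|_{W(L^p,l^p)}=\|f\|_{L^p}$ for all $f\in M$. -/

import Mathlib

open MeasureTheory Filter Topology
open scoped NNReal ENNReal OnePoint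

namespace WienerLuxemburg

/-- Lebesgue measure on the half-line `[0, ∞)`. -/
noncomputable def lam : Measure ℝ≥0 :=
  Measure.comap (fun t : ℝ≥0 => (t : ℝ)) volume

/-! ### Extended complex numbers and the class `M` -/

/-- Extended complex numbers: `ℂ` together with a point at infinity. -/
abbrev ExtComplex : Type := OnePoint ℂ

noncomputable instance : MeasurableSpace ExtComplex := borel ExtComplex

instance : BorelSpace ExtComplex := ⟨rfl⟩

/-- The modulus of an extended complex number, with `|∞| = ∞`. -/
noncomputable def modulus (z : ExtComplex) : ℝ≥0∞ :=
  z.elim ⊤ (fun w : ℂ => ‖w‖ₑ)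

/-- The inclusion of `[0, ∞]` in the extended complex numbers. -/
noncomputable def ofNonneg (x : ℝ≥0∞) : ExtComplex :=
  if x = ⊤ then ∞ else (((x.toReal : ℝ) : ℂ) : ExtComplex)

/-- Multiplication of an extended complex number by a complex number,
with `0 · ∞ = 0` and `a · ∞ = ∞` for `a ≠ 0`. -/
noncomputable def scale (a : ℂ) (z : ExtComplex) : ExtComplex :=
  z.elim (if a = 0 then ((0 : ℂ) : ExtComplex) else ∞) (fun w : ℂ => ((a * w : ℂ) : ExtComplex))

/-- Membership in `M = M([0, ∞), λ)`: Lebesgue measurable extended complex-valued functions.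
Functions that agree almost everywhere are not identified; instead, the lattice property (P2)
and rearrangement invariance each force a functional to respect equality almost everywhere. -/
def MemM (f : ℝ≥0 → ExtComplex) : Prop := AEMeasurable f lam

/-- Functionals on `M` with values in `[0, ∞]` (only the values on members of `M` matter). -/
abbrev Functional : Type := (ℝ≥0 → ExtComplex) → ℝ≥0∞

/-- A `[0, ∞]`-valued function as an extended complex-valued function. -/
noncomputable def lift (f : ℝ≥0 → ℝ≥0∞) : ℝ≥0 → ExtComplex := fun t => ofNonneg (f t)

/-- The pointwise modulus of an extended complex-valued function. -/
noncomputable def absFun (f : ℝ≥0 → ExtComplex) : ℝ≥0 → ℝ≥0∞ := fun t => modulus (f t)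

/-! ### Non-increasing rearrangement -/

/-- The distribution function of `f`. -/
noncomputable def distribution (f : ℝ≥0 → ExtComplex) (s : ℝ≥0) : ℝ≥0∞ :=
  lam {t : ℝ≥0 | (s : ℝ≥0∞) < absFun f t}

/-- The non-increasing rearrangement `f*` of `f`
(the infimum is taken in `[0, ∞]`, so it is `∞` over the empty set). -/
noncomputable def rearrangement (f : ℝ≥0 → ExtComplex) (t : ℝ≥0) : ℝ≥0∞ :=
  ⨅ (s : ℝ≥0) (_ : distribution f s ≤ (t : ℝ≥0∞)), (s : ℝ≥0∞)

/-- Two functions are equimeasurable if their distribution functions coincide. -/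
def Equimeasurable (f g : ℝ≥0 → ExtComplex) : Prop :=
  ∀ s : ℝ≥0, distribution f s = distribution g s

/-! ### Axioms of (quasi-)Banach function norms -/

/-- `‖ |f| ‖ = ‖f‖` for all `f ∈ M`. -/
def AbsInvariant (N : Functional) : Prop :=
  ∀ f : ℝ≥0 → ExtComplex, MemM f → N (lift (absFun f)) = N f

/-- Positive homogeneity on `M₊`. -/
def Homogeneous (N : Functional) : Prop :=
  ∀ (a : ℂ) (f : ℝ≥0 → ℝ≥0∞), AEMeasurable f lam →
    N (fun t => scale a (ofNonneg (f t))) = ‖a‖ₑ * N (lift f)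

/-- `‖f‖ = 0` if and only if `f = 0` almost everywhere, on `M₊`. -/
def Definite (N : Functional) : Prop :=
  ∀ f : ℝ≥0 → ℝ≥0∞, AEMeasurable f lam → (N (lift f) = 0 ↔ ∀ᵐ t ∂lam, f t = 0)

/-- Axiom (P1): `N` is a norm on `M₊`. -/
structure AxiomP1 (N : Functional) : Prop where
  homogeneous : Homogeneous N
  definite : Definite N
  subadditive : ∀ f g : ℝ≥0 → ℝ≥0∞, AEMeasurable f lam → AEMeasurable g lam →
    N (lift (fun t => f t + g t)) ≤ N (lift f) + N (lift g)

/-- Axiom (Q1): `N` is a quasinorm on `M₊`. -/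
structure AxiomQ1 (N : Functional) : Prop where
  homogeneous : Homogeneous N
  definite : Definite N
  quasi_subadditive : ∃ C : ℝ≥0, 1 ≤ C ∧
    ∀ f g : ℝ≥0 → ℝ≥0∞, AEMeasurable f lam → AEMeasurable g lam →
      N (lift (fun t => f t + g t)) ≤ (C : ℝ≥0∞) * (N (lift f) + N (lift g))

/-- Axiom (P2): the lattice property. -/
def AxiomP2 (N : Functional) : Prop :=
  ∀ f g : ℝ≥0 → ℝ≥0∞, AEMeasurable f lam → AEMeasurable g lam →
    (∀ᵐ t ∂lam, f t ≤ g t) → N (lift f) ≤ N (lift g)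

/-- Axiom (P3): the Fatou property. -/
def AxiomP3 (N : Functional) : Prop :=
  ∀ (F : ℕ → ℝ≥0 → ℝ≥0∞) (f : ℝ≥0 → ℝ≥0∞),
    (∀ n, AEMeasurable (F n) lam) → AEMeasurable f lam →
    (∀ᵐ t ∂lam, Monotone (fun n => F n t) ∧ Tendsto (fun n => F n t) atTop (𝓝 (f t))) →
    Monotone (fun n => N (lift (F n))) ∧
      Tendsto (fun n => N (lift (F n))) atTop (𝓝 (N (lift f)))

/-- Axiom (P4): characteristic functions of sets of finite measure have finite norm. -/
def AxiomP4 (N : Functional) : Prop :=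
  ∀ E : Set ℝ≥0, NullMeasurableSet E lam → lam E < ⊤ →
    N (lift (E.indicator (fun _ => 1))) < ⊤

/-- Axiom (P5): local integrability, controlled by the norm, over sets of finite measure. -/
def AxiomP5 (N : Functional) : Prop :=
  ∀ E : Set ℝ≥0, NullMeasurableSet E lam → lam E < ⊤ →
    ∃ C : ℝ≥0, ∀ f : ℝ≥0 → ℝ≥0∞, AEMeasurable f lam →
      ∫⁻ t in E, f t ∂lam ≤ (C : ℝ≥0∞) * N (lift f)

/-- Banach function norms. -/
structure IsBanachFunctionNorm (N : Functional) : Prop where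
  abs_invariant : AbsInvariant N
  p1 : AxiomP1 N
  p2 : AxiomP2 N
  p3 : AxiomP3 N
  p4 : AxiomP4 N
  p5 : AxiomP5 N

/-- Quasi-Banach function norms. -/
structure IsQuasiBanachFunctionNorm (N : Functional) : Prop where
  abs_invariant : AbsInvariant N
  q1 : AxiomQ1 N
  p2 : AxiomP2 N
  p3 : AxiomP3 N
  p4 : AxiomP4 N

/-- Rearrangement invariance. -/
def RearrangementInvariant (N : Functional) : Prop :=
  ∀ f g : ℝ≥0 → ExtComplex, MemM f → MemM g → Equimeasurable f g → N f = N g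

/-- Equivalence of functionals on `M`. -/
def EquivalentFunctionals (N₁ N₂ : Functional) : Prop :=
  ∃ C : ℝ≥0, 0 < C ∧ ∀ f : ℝ≥0 → ExtComplex, MemM f →
    (C : ℝ≥0∞)⁻¹ * N₁ f ≤ N₂ f ∧ N₂ f ≤ (C : ℝ≥0∞) * N₁ f

/-! ### Lebesgue, Wiener and Wiener–Luxemburg functionals -/

/-- The classical Lebesgue functional `‖f‖_p`. -/
noncomputable def lebesgueNorm (p : ℝ≥0∞) : Functional :=
  fun f => eLpNorm (absFun f) p lam

/-- The Wiener amalgam functional `‖f‖_{W(L^p, l^q)}`. -/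
noncomputable def wienerNorm (p q : ℝ≥0∞) : Functional :=
  fun f =>
    if q = ⊤ then
      ⨆ n : ℕ, lebesgueNorm p (lift ((Set.Ico (n : ℝ≥0) (n + 1)).indicator (absFun f)))
    else
      (∑' n : ℕ, lebesgueNorm p
        (lift ((Set.Ico (n : ℝ≥0) (n + 1)).indicator (absFun f))) ^ q.toReal) ^ (1 / q.toReal)

/-- The functional `f ↦ N (f*)`. -/
noncomputable def rearranged (N : Functional) : Functional :=
  fun f => N (lift (rearrangement f))

/-- The Wiener–Luxemburg functional
`‖f‖_{WL(A, B)} = ‖f* χ_{[0, 1]}‖_A + ‖f* χ_{(1, ∞)}‖_B`. -/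
noncomputable def wienerLuxemburg (A B : Functional) : Functional :=
  fun f => A (lift ((Set.Icc 0 1).indicator (rearrangement f))) +
    B (lift ((Set.Ioi 1).indicator (rearrangement f)))

end WienerLuxemburg

open WienerLuxemburg

namespace WienerLuxemburg

/-! ### Extended complex numbers -/

/-! Every functional involved depends only on the modulus, so the proof works with `[0, ∞]`-valued
functions and with `amalgam`, an iterated Lebesgue norm: `L^p` on each unit cell, then `l^q` with
respect to counting measure. This form treats finite and infinite exponents alike.

For the rearranged functional, splitting the measure budget gives `(g + h)*(t) ≤ g*(t/2) + h*(t/2)`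
(`decreasing_add_le`), and dilation by 2 costs at most a factor 4 (`amalgam_comp_half_le`); this is
the quasi-triangle inequality. The Fatou property comes from continuity of the measure from below
(`iSup_decreasing`). A non-increasing `h` satisfies `‖h‖_{L^p[n+1,n+2)} ≤ h(n+1) ≤
‖h‖_{L^q[n,n+1)}`, so beyond the first cell the local exponent is irrelevant up to a shift by one
cell. This yields the equivalence with the Wiener–Luxemburg functional.

For `p ≠ q` the separating functions have height `(n+1)^s` on `[n, n + (n+1)^(-r))`, with `r > 1` so
that the support has finite measure. Their amalgam norm is the `l^q` norm of `(n+1)^(s - r/p)`. If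
`q < p`, an indicator (`s = 0`) has infinite norm, against (P4). If `p < q`, the choice `s = r - 1`
gives finite norm and infinite integral, against (P5).

Rearranging these functions confines them to finitely many cells and reverses finiteness: the
indicator acquires finite norm, the non-integrable function infinite norm. A rearrangement-invariant
functional takes the same value at `g` and `g*`, and equivalence preserves finiteness, so `p = q`.
Only finiteness is compared, hence both meanings of "norm" are covered. Conversely, for `p = q` the
amalgam norm is the `L^p` norm, by summing over cells. -/

@[simp] lemma modulus_coe (w : ℂ) : modulus (w : ExtComplex) = ‖w‖ₑ := rfl

@[simp] lemma modulus_infty : modulus (∞ : ExtComplex) = ⊤ := rfl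

@[simp] lemma modulus_ofNonneg (x : ℝ≥0∞) : modulus (ofNonneg x) = x := by
  unfold ofNonneg
  split_ifs with h
  · rw [h, modulus_infty]
  · rw [modulus_coe, ← ofReal_norm, Complex.norm_real, Real.norm_of_nonneg ENNReal.toReal_nonneg,
      ENNReal.ofReal_toReal h]

@[simp] lemma absFun_lift (g : ℝ≥0 → ℝ≥0∞) : absFun (lift g) = g :=
  funext fun _ => modulus_ofNonneg _

lemma modulus_scale (a : ℂ) (z : ExtComplex) : modulus (scale a z) = ‖a‖ₑ * modulus z := by
  induction z using OnePoint.rec with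
  | infty =>
    change modulus (if a = 0 then ((0 : ℂ) : ExtComplex) else ∞) = ‖a‖ₑ * ⊤
    split_ifs with h
    · simp [h]
    · rw [modulus_infty, ENNReal.mul_top (by simpa using h)]
  | coe w =>
    change modulus ((a * w : ℂ) : ExtComplex) = ‖a‖ₑ * ‖w‖ₑ
    rw [modulus_coe, enorm_mul]

lemma absFun_scale (a : ℂ) (g : ℝ≥0 → ℝ≥0∞) :
    absFun (fun t => scale a (ofNonneg (g t))) = fun t => ‖a‖ₑ * g t := by
  funext t
  simp [absFun, modulus_scale]

lemma continuous_modulus : Continuous modulus := by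
  rw [OnePoint.continuous_iff]
  refine ⟨?_, by simpa [Function.comp_def] using continuous_enorm⟩
  rw [modulus_infty, coclosedCompact_eq_cocompact]
  simpa using (ENNReal.tendsto_ofReal_nhds_top.2 (tendsto_norm_cocompact_atTop (E := ℂ))).congr
    fun w => ofReal_norm w

lemma measurable_ofNonneg : Measurable ofNonneg := by
  unfold ofNonneg
  refine Measurable.ite (measurableSet_singleton _) measurable_const ?_
  exact OnePoint.continuous_coe.measurable.comp
    (Complex.continuous_ofReal.measurable.comp ENNReal.measurable_toReal)

lemma MemM.aemeasurable_absFun {f : ℝ≥0 → ExtComplex} (hf : MemM f) :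
    AEMeasurable (absFun f) lam :=
  continuous_modulus.measurable.comp_aemeasurable hf

lemma memM_lift {g : ℝ≥0 → ℝ≥0∞} (hg : AEMeasurable g lam) : MemM (lift g) :=
  measurable_ofNonneg.comp_aemeasurable hg

/-! ### Lebesgue measure on the half-line -/

lemma measurableEmbedding_coe : MeasurableEmbedding (fun t : ℝ≥0 => (t : ℝ)) :=
  MeasurableEmbedding.subtype_coe measurableSet_Ici

lemma lam_apply (s : Set ℝ≥0) : lam s = volume ((fun t : ℝ≥0 => (t : ℝ)) '' s) :=
  measurableEmbedding_coe.comap_apply _ _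

lemma lam_Ico (a b : ℝ≥0) : lam (Set.Ico a b) = ((b - a : ℝ≥0) : ℝ≥0∞) := by
  rw [lam_apply]
  refine (congrArg volume (NNReal.image_coe_Ico a b)).trans ?_
  rw [Real.volume_Ico, ENNReal.ofReal, NNReal.sub_def]

instance : IsFiniteMeasureOnCompacts lam :=
  .comap' _ NNReal.continuous_coe measurableEmbedding_coe

instance : SigmaFinite lam := inferInstance

instance : NullSingletonClass lam := ⟨fun x => by simp [lam_apply]⟩

lemma lam_setOf_coe_lt (x : ℝ≥0∞) : lam {t : ℝ≥0 | (t : ℝ≥0∞) < x} = x := by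
  have coe (a : ℝ≥0) : lam {t : ℝ≥0 | (t : ℝ≥0∞) < a} = a := by
    have : {t : ℝ≥0 | (t : ℝ≥0∞) < a} = Set.Ico 0 a := by ext t; simp
    rw [this, lam_Ico, tsub_zero]
  induction x with
  | coe a => exact coe a
  | top =>
    refine ENNReal.eq_top_of_forall_nnreal_le fun r => ?_
    rw [← coe r]
    exact measure_mono fun t _ => ENNReal.coe_lt_top

lemma map_half_lam : lam.map (fun t : ℝ≥0 => t / 2) = (2 : ℝ≥0∞) • lam := by
  ext s hs
  rw [Measure.map_apply (by fun_prop) hs, Measure.smul_apply, lam_apply, lam_apply]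
  have : (fun t : ℝ≥0 => (t : ℝ)) '' ((fun t : ℝ≥0 => t / 2) ⁻¹' s) =
      (fun t : ℝ => 2 * t) '' ((fun t : ℝ≥0 => (t : ℝ)) '' s) := by
    ext x
    simp only [Set.mem_image, Set.mem_preimage, exists_exists_and_eq_and]
    constructor
    · rintro ⟨t, ht, rfl⟩
      exact ⟨t / 2, ht, by push_cast; ring⟩
    · rintro ⟨t, ht, rfl⟩
      exact ⟨2 * t, by simpa using ht, by push_cast; ring⟩
  rw [this]
  have h := Measure.addHaar_smul (volume : Measure ℝ) 2 ((fun t : ℝ≥0 => (t : ℝ)) '' s)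
  simp only [Module.finrank_self, pow_one] at h
  rw [← Set.image_smul] at h
  simpa using h

/-! ### Lebesgue norms of `[0, ∞]`-valued functions -/

section eLpNorm

variable {α β : Type*} [MeasurableSpace α] [MeasurableSpace β] {μ : Measure α} {ν : Measure β}
  {p : ℝ≥0∞}

lemma eLpNorm_const_mul_ennreal {c : ℝ≥0∞} (hc : c ≠ ⊤) (g : α → ℝ≥0∞) (p : ℝ≥0∞) :
    eLpNorm (fun t => c * g t) p μ = c * eLpNorm g p μ := by
  rcases eq_or_ne p 0 with rfl | hp0
  · simp
  rcases eq_or_ne p ⊤ with rfl | hp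
  · simp only [eLpNorm_exponent_top, eLpNormEssSup, enorm_eq_self]
    exact ENNReal.essSup_const_mul
  have hr : 0 < p.toReal := ENNReal.toReal_pos hp0 hp
  simp only [eLpNorm_eq_lintegral_rpow_enorm_toReal hp0 hp, enorm_eq_self]
  simp_rw [ENNReal.mul_rpow_of_nonneg _ _ hr.le]
  rw [lintegral_const_mul' _ _ (ENNReal.rpow_ne_top_of_nonneg hr.le hc),
    ENNReal.mul_rpow_of_nonneg _ _ (by positivity), ← ENNReal.rpow_mul,
    mul_one_div_cancel hr.ne', ENNReal.rpow_one]

/-- Monotone convergence for Lebesgue norms. -/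
lemma eLpNorm_iSup_of_monotone {F : ℕ → α → ℝ≥0∞} {g : α → ℝ≥0∞}
    (hF : ∀ n, AEMeasurable (F n) μ)
    (h : ∀ᵐ t ∂μ, Monotone (fun n => F n t) ∧ ⨆ n, F n t = g t) (p : ℝ≥0∞) :
    ⨆ n, eLpNorm (F n) p μ = eLpNorm g p μ := by
  refine le_antisymm (iSup_le fun n => eLpNorm_mono_enorm_ae ?_) ?_
  · filter_upwards [h] with t ht
    simpa [← ht.2] using le_iSup (fun n => F n t) n
  rcases eq_or_ne p 0 with rfl | hp0
  · simp
  rcases eq_or_ne p ⊤ with rfl | hp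
  · simp only [eLpNorm_exponent_top, eLpNormEssSup, enorm_eq_self]
    refine essSup_le_of_ae_le _ ?_
    have := ae_all_iff.2 fun n => ae_le_essSup (f := F n) (μ := μ)
    filter_upwards [this, h] with t ht ht'
    rw [← ht'.2]
    exact iSup_mono ht
  have hr : 0 < p.toReal := ENNReal.toReal_pos hp0 hp
  simp only [eLpNorm_eq_lintegral_rpow_enorm_toReal hp0 hp, enorm_eq_self]
  have key : ∫⁻ t, g t ^ p.toReal ∂μ = ⨆ n, ∫⁻ t, F n t ^ p.toReal ∂μ := by
    rw [← lintegral_iSup' (fun n => (hF n).pow_const _)]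
    · refine lintegral_congr_ae ?_
      filter_upwards [h] with t ht
      rw [← ht.2]
      exact (ENNReal.orderIsoRpow _ hr).map_iSup _
    · filter_upwards [h] with t ht m n hmn
      exact ENNReal.rpow_le_rpow (ht.1 hmn) hr.le
  rw [key]
  exact ((ENNReal.orderIsoRpow _ (one_div_pos.2 hr)).map_iSup _).le

/-- The change of measure costs `2^(1/p)`, which is at most 2 for `p ≥ 1`, including `p = ⊤`. It
serves both for the dilation inside a cell and for the map `n ↦ n / 2` on cell indices. -/
lemma eLpNorm_comp_le_two_mul {φ : α → β} (hφ : Measurable φ) {h : β → ℝ≥0∞} (hh : Measurable h)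
    (hmap : μ.map φ ≤ (2 : ℝ≥0∞) • ν) (hp : 1 ≤ p) :
    eLpNorm (h ∘ φ) p μ ≤ 2 * eLpNorm h p ν := by
  rw [← eLpNorm_map_measure hh.aestronglyMeasurable hφ.aemeasurable]
  refine (eLpNorm_mono_measure _ hmap).trans ?_
  rw [eLpNorm_smul_measure_of_ne_zero two_ne_zero, smul_eq_mul]
  gcongr
  refine (ENNReal.rpow_le_rpow_of_exponent_le one_le_two (y := (1 / p).toReal) (z := 1) ?_).trans_eq
    (ENNReal.rpow_one _)
  exact ENNReal.toReal_le_of_le_ofReal zero_le_one (by simpa using hp)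

/-- The layer cake formula for `[0, ∞]`-valued functions. -/
lemma lintegral_eq_lintegral_measure_lt [SFinite μ] {g : α → ℝ≥0∞} (hg : AEMeasurable g μ) :
    ∫⁻ t, g t ∂μ = ∫⁻ s, μ {t | (s : ℝ≥0∞) < g t} ∂lam := by
  wlog hm : Measurable g generalizing g
  · rw [lintegral_congr_ae hg.ae_eq_mk, this hg.measurable_mk.aemeasurable hg.measurable_mk]
    refine lintegral_congr fun s => measure_congr ?_
    filter_upwards [hg.ae_eq_mk] with t ht
    change ((s : ℝ≥0∞) < hg.mk g t) = (s < g t)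
    rw [ht]
  -- Tonelli for the region under the graph: its slice over `t` is `{s | s < g t}`, of Lebesgue
  -- measure `g t` even when that is `⊤`.
  have hS : MeasurableSet {x : α × ℝ≥0 | (x.2 : ℝ≥0∞) < g x.1} :=
    measurableSet_lt (by fun_prop) (by fun_prop)
  have h := (Measure.prod_apply (μ := μ) (ν := lam) hS).symm.trans (Measure.prod_apply_symm hS)
  simpa only [Set.preimage_ofPred_eq, lam_setOf_coe_lt] using h

/-- For finite `p` the layer cake formula applied to the `p`-th power sees only superlevel sets; for
`p = ⊤` the essential supremum is the infimum of the levels with null superlevel set. -/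
lemma eLpNorm_eq_of_measure_lt_eq [SFinite μ] [SFinite ν] {g : α → ℝ≥0∞} {h : β → ℝ≥0∞}
    (hg : AEMeasurable g μ) (hh : AEMeasurable h ν)
    (hd : ∀ s : ℝ≥0, μ {t | (s : ℝ≥0∞) < g t} = ν {t | (s : ℝ≥0∞) < h t}) (p : ℝ≥0∞) :
    eLpNorm g p μ = eLpNorm h p ν := by
  rcases eq_or_ne p 0 with rfl | hp0
  · simp
  rcases eq_or_ne p ⊤ with rfl | hp
  · simp only [eLpNorm_exponent_top, eLpNormEssSup, enorm_eq_self, essSup_eq_sInf]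
    congr 1
    ext a
    induction a with
    | coe s => simp [hd]
    | top => simp
  have hr : 0 < p.toReal := ENNReal.toReal_pos hp0 hp
  simp only [eLpNorm_eq_lintegral_rpow_enorm_toReal hp0 hp, enorm_eq_self]
  rw [lintegral_eq_lintegral_measure_lt (hg.pow_const _),
    lintegral_eq_lintegral_measure_lt (hh.pow_const _)]
  have root (s : ℝ≥0) (x : ℝ≥0∞) :
      (s : ℝ≥0∞) < x ^ p.toReal ↔ ((s ^ (1 / p.toReal) : ℝ≥0) : ℝ≥0∞) < x := by
    rw [ENNReal.coe_rpow_of_nonneg _ (one_div_pos.2 hr).le, one_div, ENNReal.rpow_inv_lt_iff hr]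
  simp only [root, hd]

end eLpNorm

/-! ### The Wiener amalgam norm of `[0, ∞]`-valued functions -/

/-- Lebesgue measure on the unit cell `[n, n + 1)`. -/
noncomputable def cell (n : ℕ) : Measure ℝ≥0 := lam.restrict (Set.Ico (n : ℝ≥0) (n + 1))

instance (n : ℕ) : IsProbabilityMeasure (cell n) :=
  ⟨by rw [cell, Measure.restrict_apply_univ, lam_Ico, add_tsub_cancel_left, ENNReal.coe_one]⟩

lemma cell_le (n : ℕ) : cell n ≤ lam := Measure.restrict_le_self

lemma ae_cell {n : ℕ} {P : ℝ≥0 → Prop} (h : ∀ t : ℝ≥0, (n : ℝ≥0) ≤ t → t < n + 1 → P t) :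
    ∀ᵐ t ∂cell n, P t :=
  (ae_restrict_iff' measurableSet_Ico).2 (ae_of_all _ fun t ht => h t ht.1 ht.2)

lemma iUnion_Ico_natCast : ⋃ n : ℕ, Set.Ico (n : ℝ≥0) (n + 1) = Set.univ :=
  Set.eq_univ_of_forall fun t =>
    Set.mem_iUnion.2 ⟨⌊t⌋₊, Nat.floor_le zero_le, Nat.lt_floor_add_one t⟩

lemma pairwise_disjoint_Ico_natCast :
    Pairwise (Function.onFun Disjoint fun n : ℕ => Set.Ico (n : ℝ≥0) (n + 1)) := by
  have h (n : ℕ) (t : ℝ≥0) (ht : t ∈ Set.Ico (n : ℝ≥0) (n + 1)) : ⌊t⌋₊ = n :=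
    (Nat.floor_eq_iff zero_le).2 ht
  exact fun m n hmn => Set.disjoint_left.2 fun t hm hn => hmn ((h m t hm).symm.trans (h n t hn))

lemma lintegral_lam_eq_tsum (g : ℝ≥0 → ℝ≥0∞) : ∫⁻ t, g t ∂lam = ∑' n, ∫⁻ t, g t ∂cell n := by
  rw [← setLIntegral_univ, ← iUnion_Ico_natCast,
    lintegral_iUnion (fun _ => measurableSet_Ico) pairwise_disjoint_Ico_natCast]
  rfl

lemma ae_lam_iff {P : ℝ≥0 → Prop} : (∀ᵐ t ∂lam, P t) ↔ ∀ n, ∀ᵐ t ∂cell n, P t := by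
  rw [← Measure.restrict_univ (μ := lam), ← iUnion_Ico_natCast, ae_restrict_iUnion_iff]
  rfl

/-- The Wiener amalgam functional on `[0, ∞]`-valued functions. -/
noncomputable def amalgam (p q : ℝ≥0∞) (g : ℝ≥0 → ℝ≥0∞) : ℝ≥0∞ :=
  eLpNorm (fun n : ℕ => eLpNorm g p (cell n)) q Measure.count

lemma wienerNorm_eq {p q : ℝ≥0∞} (hq : q ≠ 0) (f : ℝ≥0 → ExtComplex) :
    wienerNorm p q f = amalgam p q (absFun f) := by
  unfold wienerNorm amalgam lebesgueNorm
  simp only [absFun_lift, eLpNorm_indicator_eq_eLpNorm_restrict measurableSet_Ico, cell]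
  split_ifs with h
  · simp only [h, eLpNorm_exponent_top, eLpNormEssSup, enorm_eq_self, essSup_count]
  · simp only [eLpNorm_eq_lintegral_rpow_enorm_toReal hq h, enorm_eq_self, lintegral_count]

lemma wienerNorm_lift {p q : ℝ≥0∞} (hq : q ≠ 0) (g : ℝ≥0 → ℝ≥0∞) :
    wienerNorm p q (lift g) = amalgam p q g := by
  rw [wienerNorm_eq hq, absFun_lift]

/-- For equal exponents the amalgam functional is the Lebesgue functional. -/
lemma amalgam_self (p : ℝ≥0∞) (g : ℝ≥0 → ℝ≥0∞) : amalgam p p g = eLpNorm g p lam := by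
  unfold amalgam
  rcases eq_or_ne p 0 with rfl | hp0
  · simp
  rcases eq_or_ne p ⊤ with rfl | hp
  · simp only [eLpNorm_exponent_top, eLpNormEssSup, enorm_eq_self, essSup_count]
    refine le_antisymm (iSup_le fun n => ?_) (essSup_le_of_ae_le _ ?_)
    · exact essSup_mono_measure (cell_le n).absolutelyContinuous
    · refine ae_lam_iff.2 fun n => ?_
      filter_upwards [ae_le_essSup (f := g) (μ := cell n)] with t ht
      exact ht.trans (le_iSup (fun n => essSup g (cell n)) n)
  have hr : 0 < p.toReal := ENNReal.toReal_pos hp0 hp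
  simp only [eLpNorm_eq_lintegral_rpow_enorm_toReal hp0 hp, enorm_eq_self, lintegral_count]
  simp_rw [← ENNReal.rpow_mul, one_div_mul_cancel hr.ne', ENNReal.rpow_one]
  rw [lintegral_lam_eq_tsum]

lemma lintegral_lam_eq_tsum_eLpNorm (g : ℝ≥0 → ℝ≥0∞) :
    ∫⁻ t, g t ∂lam = ∑' n, eLpNorm g 1 (cell n) := by
  simp only [eLpNorm_one_eq_lintegral_enorm, enorm_eq_self, lintegral_lam_eq_tsum]

lemma amalgam_mono {p q : ℝ≥0∞} {g h : ℝ≥0 → ℝ≥0∞} (hgh : ∀ᵐ t ∂lam, g t ≤ h t) :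
    amalgam p q g ≤ amalgam p q h :=
  eLpNorm_mono_enorm fun n => eLpNorm_mono_enorm_ae (ae_lam_iff.1 hgh n)

lemma amalgam_const_mul {p q c : ℝ≥0∞} (hc : c ≠ ⊤) (g : ℝ≥0 → ℝ≥0∞) :
    amalgam p q (fun t => c * g t) = c * amalgam p q g := by
  simp only [amalgam, eLpNorm_const_mul_ennreal hc]

lemma aestronglyMeasurable_cell {g : ℝ≥0 → ℝ≥0∞} (hg : AEMeasurable g lam) (n : ℕ) :
    AEStronglyMeasurable g (cell n) :=
  (hg.mono_measure (cell_le n)).aestronglyMeasurable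

lemma amalgam_eq_zero_iff {p q : ℝ≥0∞} (hp : p ≠ 0) (hq : q ≠ 0) {g : ℝ≥0 → ℝ≥0∞}
    (hg : AEMeasurable g lam) : amalgam p q g = 0 ↔ ∀ᵐ t ∂lam, g t = 0 := by
  rw [amalgam, eLpNorm_eq_zero_iff (measurable_of_countable _).aestronglyMeasurable hq,
    EventuallyEq, Measure.ae_count_iff, ae_lam_iff]
  exact forall_congr' fun n => eLpNorm_eq_zero_iff (aestronglyMeasurable_cell hg n) hp

lemma amalgam_add_le {p q : ℝ≥0∞} (hp : 1 ≤ p) (hq : 1 ≤ q) {g h : ℝ≥0 → ℝ≥0∞}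
    (hg : AEMeasurable g lam) (hh : AEMeasurable h lam) :
    amalgam p q (fun t => g t + h t) ≤ amalgam p q g + amalgam p q h := by
  refine le_trans ?_ (eLpNorm_add_le (measurable_of_countable _).aestronglyMeasurable
    (measurable_of_countable _).aestronglyMeasurable hq)
  exact eLpNorm_mono_enorm fun n =>
    eLpNorm_add_le (aestronglyMeasurable_cell hg n) (aestronglyMeasurable_cell hh n) hp

lemma amalgam_iSup_of_monotone {p q : ℝ≥0∞} {F : ℕ → ℝ≥0 → ℝ≥0∞} {g : ℝ≥0 → ℝ≥0∞}
    (hF : ∀ n, AEMeasurable (F n) lam)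
    (h : ∀ᵐ t ∂lam, Monotone (fun n => F n t) ∧ ⨆ n, F n t = g t) :
    ⨆ n, amalgam p q (F n) = amalgam p q g := by
  refine eLpNorm_iSup_of_monotone (fun _ => (measurable_of_countable _).aemeasurable)
    (ae_of_all _ fun k => ⟨fun m n hmn => ?_, ?_⟩) q
  · refine eLpNorm_mono_enorm_ae ?_
    filter_upwards [ae_lam_iff.1 h k] with t ht using ht.1 hmn
  · exact eLpNorm_iSup_of_monotone (fun n => (hF n).mono_measure (cell_le k)) (ae_lam_iff.1 h k) p

/-- One term of a sequence is its Lebesgue norm for a Dirac mass, which counting measure dominates.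
-/
lemma eLpNorm_cell_le_amalgam {p q : ℝ≥0∞} (hq : q ≠ 0) (g : ℝ≥0 → ℝ≥0∞) (n : ℕ) :
    eLpNorm g p (cell n) ≤ amalgam p q g := by
  have hle : Measure.dirac n ≤ (Measure.count : Measure ℕ) := Measure.le_sum _ n
  refine le_trans ?_ (eLpNorm_mono_measure _ hle)
  rw [eLpNorm_congr_ae (ae_eq_dirac _)]
  change _ ≤ eLpNorm (fun _ : ℕ => eLpNorm g p (cell n)) q (Measure.dirac n)
  rw [eLpNorm_const _ hq (NeZero.ne _), measure_univ, ENNReal.one_rpow, mul_one, enorm_eq_self]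

/-- A dilation by `2` increases the amalgam functional at most by the factor `4`. -/
lemma amalgam_comp_half_le {p q : ℝ≥0∞} (hp : 1 ≤ p) (hq : 1 ≤ q) {h : ℝ≥0 → ℝ≥0∞}
    (hh : Measurable h) : amalgam p q (fun t => h (t / 2)) ≤ 4 * amalgam p q h := by
  -- Halving sends cell `n` into the cell with index `n / 2` (integer division).
  have hcell (n : ℕ) : (cell n).map (fun t : ℝ≥0 => t / 2) ≤ (2 : ℝ≥0∞) • cell (n / 2) := by
    have hsub : Set.Ico (n : ℝ≥0) (n + 1) ⊆
        (fun t : ℝ≥0 => t / 2) ⁻¹' Set.Ico ((n / 2 : ℕ) : ℝ≥0) ((n / 2 : ℕ) + 1) := by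
      rintro t ⟨h1, h2⟩
      have h3 : (2 * (n / 2) : ℕ) ≤ n := by omega
      have h4 : n + 1 ≤ 2 * (n / 2 + 1) := by omega
      constructor
      · rw [le_div_iff₀ two_pos, mul_comm]
        exact le_trans (mod_cast h3) h1
      · rw [div_lt_iff₀ two_pos, mul_comm]
        exact h2.trans_le (mod_cast h4)
    calc (cell n).map (fun t : ℝ≥0 => t / 2)
        ≤ (lam.restrict ((fun t : ℝ≥0 => t / 2) ⁻¹'
            Set.Ico ((n / 2 : ℕ) : ℝ≥0) ((n / 2 : ℕ) + 1))).map (fun t : ℝ≥0 => t / 2) :=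
          Measure.map_mono (Measure.restrict_mono hsub le_rfl) (by fun_prop)
      _ = (2 : ℝ≥0∞) • cell (n / 2) := by
          rw [← Measure.restrict_map (by fun_prop) measurableSet_Ico, map_half_lam,
            Measure.restrict_smul, cell]
  -- Each index `k` equals `n / 2` for exactly two `n`, namely `2k` and `2k + 1`. This second factor
  -- 2, on top of the one inside the cells, makes the constant 4.
  have hcount : (Measure.count : Measure ℕ).map (fun n => n / 2) ≤
      (2 : ℝ≥0∞) • Measure.count := by
    refine Measure.le_iff.2 fun s hs => ?_
    have hsub : (fun n => n / 2) ⁻¹' s ⊆ (fun n => 2 * n) '' s ∪ (fun n => 2 * n + 1) '' s := by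
      intro n hn
      rcases Nat.even_or_odd' n with ⟨k, rfl | rfl⟩
      · exact Or.inl ⟨k, by simpa using hn, rfl⟩
      · exact Or.inr ⟨k, by simpa [Nat.mul_add_div] using hn, rfl⟩
    rw [Measure.map_apply (measurable_of_countable _) hs, Measure.smul_apply, smul_eq_mul, two_mul]
    refine (measure_mono hsub).trans ((measure_union_le _ _).trans_eq ?_)
    rw [Measure.count_injective_image (fun a b h => by simpa using h),
      Measure.count_injective_image (fun a b h => by simpa using h)]
  calc amalgam p q (fun t => h (t / 2))
      ≤ eLpNorm (fun n : ℕ => 2 * eLpNorm h p (cell (n / 2))) q Measure.count :=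
        eLpNorm_mono_enorm fun n => eLpNorm_comp_le_two_mul (by fun_prop) hh (hcell n) hp
    _ = 2 * eLpNorm ((fun n : ℕ => eLpNorm h p (cell n)) ∘ fun n => n / 2) q Measure.count :=
        eLpNorm_const_mul_ennreal (by simp) _ _
    _ ≤ 2 * (2 * amalgam p q h) := by
        gcongr
        exact eLpNorm_comp_le_two_mul (measurable_of_countable _) (measurable_of_countable _)
          hcount hq
    _ = 4 * amalgam p q h := by rw [← mul_assoc]; norm_num

/-! ### Non-increasing rearrangement of `[0, ∞]`-valued functions -/

/-- The non-increasing rearrangement of a `[0, ∞]`-valued function. -/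
noncomputable def decreasing (g : ℝ≥0 → ℝ≥0∞) (t : ℝ≥0) : ℝ≥0∞ :=
  ⨅ (s : ℝ≥0) (_ : lam {u | (s : ℝ≥0∞) < g u} ≤ t), (s : ℝ≥0∞)

lemma rearrangement_eq (f : ℝ≥0 → ExtComplex) : rearrangement f = decreasing (absFun f) := rfl

lemma decreasing_le {g : ℝ≥0 → ℝ≥0∞} {s t : ℝ≥0} (h : lam {u | (s : ℝ≥0∞) < g u} ≤ t) :
    decreasing g t ≤ s :=
  iInf₂_le s h

lemma lam_superlevel_le_of_decreasing_lt {g : ℝ≥0 → ℝ≥0∞} {s t : ℝ≥0}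
    (h : decreasing g t < s) : lam {u | (s : ℝ≥0∞) < g u} ≤ t := by
  simp only [decreasing, iInf_lt_iff] at h
  obtain ⟨r, hr, hrs⟩ := h
  exact (measure_mono fun u hu => hrs.trans hu).trans hr

lemma antitone_decreasing (g : ℝ≥0 → ℝ≥0∞) : Antitone (decreasing g) := fun _ _ h =>
  le_iInf₂ fun _ hs => decreasing_le (hs.trans (mod_cast h))

lemma measurable_decreasing (g : ℝ≥0 → ℝ≥0∞) : Measurable (decreasing g) :=
  (antitone_decreasing g).measurable

lemma decreasing_mono {g h : ℝ≥0 → ℝ≥0∞} (hgh : ∀ᵐ t ∂lam, g t ≤ h t) (t : ℝ≥0) :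
    decreasing g t ≤ decreasing h t :=
  le_iInf₂ fun _ hs => decreasing_le ((measure_mono_ae (by
    filter_upwards [hgh] with u hu h using lt_of_lt_of_le h hu)).trans hs)

lemma decreasing_congr_lam {g h : ℝ≥0 → ℝ≥0∞}
    (hgh : ∀ s : ℝ≥0, lam {u | (s : ℝ≥0∞) < g u} = lam {u | (s : ℝ≥0∞) < h u}) :
    decreasing g = decreasing h := by
  funext t
  simp only [decreasing, hgh]

/-- The infimum defining `decreasing` is attained because the distribution function is
right-continuous: `{s < g}` is the increasing union of the sets `{s + 1/(n+1) < g}`. -/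
lemma lt_decreasing_iff {g : ℝ≥0 → ℝ≥0∞} {s t : ℝ≥0} :
    (s : ℝ≥0∞) < decreasing g t ↔ (t : ℝ≥0∞) < lam {u | (s : ℝ≥0∞) < g u} := by
  refine ⟨fun h => not_le.1 fun h' => (decreasing_le h').not_gt h, fun h => ?_⟩
  have hmono : Monotone fun n : ℕ => {u | ((s + 1 / ((n : ℝ≥0) + 1) : ℝ≥0) : ℝ≥0∞) < g u} := by
    intro m n hmn u hu
    refine lt_of_le_of_lt (b := ((s + 1 / ((m : ℝ≥0) + 1) : ℝ≥0) : ℝ≥0∞)) ?_ hu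
    have : 1 / ((n : ℝ≥0) + 1) ≤ 1 / ((m : ℝ≥0) + 1) := 
      one_div_le_one_div_of_le (by positivity) (by gcongr)
    exact_mod_cast add_le_add_right this s
  have hU : {u | (s : ℝ≥0∞) < g u} =
      ⋃ n : ℕ, {u | ((s + 1 / ((n : ℝ≥0) + 1) : ℝ≥0) : ℝ≥0∞) < g u} := by
    ext u
    simp only [Set.mem_iUnion]
    refine ⟨fun hu => ?_, fun ⟨n, hn⟩ => ?_⟩
    swap
    · exact lt_of_le_of_lt (ENNReal.coe_le_coe.2 le_self_add) (hn)
    obtain ⟨r, hsr, hr⟩ := ENNReal.lt_iff_exists_nnreal_btwn.1 hu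
    rw [ENNReal.coe_lt_coe] at hsr
    obtain ⟨n, hn⟩ := exists_nat_one_div_lt (K := ℝ≥0) (tsub_pos_of_lt hsr)
    refine ⟨n, lt_trans ?_ hr⟩
    exact_mod_cast lt_tsub_iff_left.1 hn
  rw [hU, hmono.measure_iUnion, lt_iSup_iff] at h
  obtain ⟨n, hn⟩ := h
  refine lt_of_lt_of_le (b := ((s + 1 / ((n : ℝ≥0) + 1) : ℝ≥0) : ℝ≥0∞)) ?_ ?_
  · exact_mod_cast lt_add_of_pos_right s (by positivity)
  · exact not_lt.1 fun h' => (lam_superlevel_le_of_decreasing_lt h').not_gt hn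

/-- A function and its non-increasing rearrangement are equimeasurable. -/
lemma lam_lt_decreasing (g : ℝ≥0 → ℝ≥0∞) (s : ℝ≥0) :
    lam {t | (s : ℝ≥0∞) < decreasing g t} = lam {t | (s : ℝ≥0∞) < g t} := by
  -- The superlevel set of the rearrangement is an initial interval whose length is the value of the
  -- distribution function.
  simp only [lt_decreasing_iff, lam_setOf_coe_lt]

lemma decreasing_const_mul {c : ℝ≥0} (g : ℝ≥0 → ℝ≥0∞) :
    decreasing (fun t => c * g t) = fun t => c * decreasing g t := by
  funext t
  rcases eq_or_ne c 0 with rfl | hc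
  · have h0 : decreasing (fun u => ((0 : ℝ≥0) : ℝ≥0∞) * g u) t ≤ ((0 : ℝ≥0) : ℝ≥0∞) :=
      decreasing_le (by simp)
    simpa using h0
  have hc' : (c : ℝ≥0∞) ≠ 0 := by simpa using hc
  have hlt (s : ℝ≥0) (x : ℝ≥0∞) : ((c * s : ℝ≥0) : ℝ≥0∞) < c * x ↔ (s : ℝ≥0∞) < x := by
    rw [ENNReal.coe_mul, ENNReal.mul_lt_mul_iff_right hc' ENNReal.coe_ne_top]
  refine le_antisymm ?_ (le_iInf₂ fun s hs => ?_)
  · change _ ≤ (c : ℝ≥0∞) * ⨅ (s : ℝ≥0) (_ : lam {u | (s : ℝ≥0∞) < g u} ≤ t), (s : ℝ≥0∞)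
    simp only [ENNReal.mul_iInf_of_ne hc' ENNReal.coe_ne_top]
    refine le_iInf₂ fun s hs => ?_
    rw [← ENNReal.coe_mul]
    exact decreasing_le (by simpa only [hlt] using hs)
  · obtain ⟨r, rfl⟩ : ∃ r, s = c * r := ⟨s / c, (mul_div_cancel₀ s hc).symm⟩
    simp only [hlt] at hs
    rw [ENNReal.coe_mul]
    gcongr
    exact decreasing_le hs

/-- The budget `t` is split evenly: `g + h` exceeds `r + s` only where `g` exceeds `r` or `h`
exceeds `s`, and each of these sets has measure at most `t/2`. -/
lemma decreasing_add_le (g h : ℝ≥0 → ℝ≥0∞) (t : ℝ≥0) :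
    decreasing (fun u => g u + h u) t ≤ decreasing g (t / 2) + decreasing h (t / 2) := by
  simp only [decreasing, ENNReal.iInf_add, ENNReal.add_iInf]
  refine le_iInf₂ fun s hs => le_iInf₂ fun r hr => ?_
  rw [← ENNReal.coe_add]
  refine decreasing_le ?_
  have hsub : {u | ((r + s : ℝ≥0) : ℝ≥0∞) < g u + h u} ⊆
      {u | (r : ℝ≥0∞) < g u} ∪ {u | (s : ℝ≥0∞) < h u} := by
    intro u hu
    by_contra hn
    simp only [Set.mem_union, Set.mem_ofPred_eq, not_or, not_lt] at hn hu
    exact (add_le_add hn.1 hn.2).not_gt (by simpa using hu)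
  refine (measure_mono hsub).trans ((measure_union_le _ _).trans ((add_le_add hr hs).trans_eq ?_))
  rw [← ENNReal.coe_add, add_halves]

lemma decreasing_ae_eq_zero_iff {g : ℝ≥0 → ℝ≥0∞} :
    (∀ᵐ t ∂lam, decreasing g t = 0) ↔ ∀ᵐ t ∂lam, g t = 0 := by
  have h := lam_lt_decreasing g 0
  simp only [ae_iff, ← Ne.eq_def, ← pos_iff_ne_zero]
  rw [ENNReal.coe_zero] at h
  rw [h]

/-- The rearrangement has the Fatou property. -/
lemma iSup_decreasing {F : ℕ → ℝ≥0 → ℝ≥0∞} {g : ℝ≥0 → ℝ≥0∞}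
    (h : ∀ᵐ t ∂lam, Monotone (fun n => F n t) ∧ ⨆ n, F n t = g t) (t : ℝ≥0) :
    ⨆ n, decreasing (F n) t = decreasing g t := by
  refine le_antisymm (iSup_le fun n => decreasing_mono ?_ t) ?_
  · filter_upwards [h] with u hu
    exact hu.2 ▸ le_iSup (fun n => F n u) n
  refine ENNReal.le_of_forall_nnreal_lt fun s hs => ?_
  rw [lt_decreasing_iff] at hs
  have hU : lam {u | (s : ℝ≥0∞) < g u} ≤ ⨆ n, lam {u | (s : ℝ≥0∞) < F n u} := by
    calc lam {u | (s : ℝ≥0∞) < g u} ≤ lam (⋃ n, {u | (s : ℝ≥0∞) < F n u}) := by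
          refine measure_mono_ae ?_
          filter_upwards [h] with u hu hs
          have hs' : (s : ℝ≥0∞) < ⨆ n, F n u := hu.2.symm ▸ hs
          exact Set.mem_iUnion.2 (lt_iSup_iff.1 hs')
      -- The sets `{s < F n}` increase only up to null sets, so continuity from below is applied to
      -- their accumulated unions.
      _ = ⨆ n, lam (Set.accumulate (fun n => {u | (s : ℝ≥0∞) < F n u}) n) :=
          measure_iUnion_eq_iSup_accumulate
      _ ≤ ⨆ n, lam {u | (s : ℝ≥0∞) < F n u} := by
          refine iSup_mono fun n => measure_mono_ae ?_
          filter_upwards [h] with u hu hs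
          obtain ⟨m, hm, hs⟩ := Set.mem_accumulate.1 hs
          exact lt_of_lt_of_le hs (hu.1 hm)
  obtain ⟨n, hn⟩ := lt_iSup_iff.1 (hs.trans_le hU)
  exact (lt_decreasing_iff.2 hn).le.trans (le_iSup (fun n => decreasing (F n) t) n)

/-- Lebesgue norms are invariant under the non-increasing rearrangement. -/
lemma eLpNorm_decreasing {g : ℝ≥0 → ℝ≥0∞} (hg : AEMeasurable g lam) (p : ℝ≥0∞) :
    eLpNorm (decreasing g) p lam = eLpNorm g p lam :=
  eLpNorm_eq_of_measure_lt_eq (measurable_decreasing g).aemeasurable hg (lam_lt_decreasing g) p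

/-- The rearrangement of a function vanishing off a set of measure at most `t` vanishes
on `[t, ∞)`. -/
lemma decreasing_eq_zero {g : ℝ≥0 → ℝ≥0∞} {E : Set ℝ≥0} (hE : ∀ u ∉ E, g u = 0) {t : ℝ≥0}
    (ht : lam E ≤ t) : decreasing g t = 0 := by
  have : {u | ((0 : ℝ≥0) : ℝ≥0∞) < g u} ⊆ E := fun u hu => by
    by_contra h
    exact hu.ne' (hE u h)
  simpa using decreasing_le ((measure_mono this).trans ht)

/-! ### Amalgam norms of non-increasing functions -/

lemma eLpNorm_cell_const (p : ℝ≥0∞) (hp : p ≠ 0) (c : ℝ≥0∞) (n : ℕ) :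
    eLpNorm (fun _ => c) p (cell n) = c := by
  rw [eLpNorm_const _ hp (NeZero.ne _), measure_univ, ENNReal.one_rpow, mul_one, enorm_eq_self]

lemma eLpNorm_cell_le_of_antitone {h : ℝ≥0 → ℝ≥0∞} (hh : Antitone h) {p : ℝ≥0∞} (hp : p ≠ 0)
    (n : ℕ) : eLpNorm h p (cell n) ≤ h n :=
  (eLpNorm_mono_enorm_ae (ae_cell fun _ ht _ => hh ht)).trans_eq (eLpNorm_cell_const p hp (h n) n)

lemma le_eLpNorm_cell_of_antitone {h : ℝ≥0 → ℝ≥0∞} (hh : Antitone h) {p : ℝ≥0∞} (hp : p ≠ 0)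
    (n : ℕ) : h (n + 1) ≤ eLpNorm h p (cell n) :=
  (eLpNorm_cell_const p hp (h (n + 1)) n).symm.trans_le
    (eLpNorm_mono_enorm_ae (ae_cell fun _ _ ht => hh ht.le))

/-- On non-increasing functions the local component at one cell is controlled by any other local
component at the preceding cell. -/
lemma eLpNorm_cell_succ_le_of_antitone {h : ℝ≥0 → ℝ≥0∞} (hh : Antitone h) {p q : ℝ≥0∞}
    (hp : p ≠ 0) (hq : q ≠ 0) (n : ℕ) : eLpNorm h p (cell (n + 1)) ≤ eLpNorm h q (cell n) :=
  (eLpNorm_cell_le_of_antitone hh hp (n + 1)).trans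
    (by simpa using le_eLpNorm_cell_of_antitone hh hq n)

lemma map_succ_count_le : (Measure.count : Measure ℕ).map Nat.succ ≤ Measure.count := by
  refine Measure.le_iff.2 fun s hs => ?_
  rw [Measure.map_apply (measurable_of_countable _) hs,
    ← Measure.count_injective_image Nat.succ_injective]
  exact measure_mono (Set.image_preimage_subset _ _)

lemma restrict_count_le_map_succ :
    (Measure.count : Measure ℕ).restrict {0}ᶜ ≤ Measure.count.map Nat.succ := by
  refine Measure.le_iff.2 fun s hs => ?_
  rw [Measure.map_apply (measurable_of_countable _) hs, Measure.restrict_apply hs,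
    ← Measure.count_injective_image Nat.succ_injective (Nat.succ ⁻¹' s)]
  refine measure_mono ?_
  rintro n ⟨hn, h0⟩
  obtain ⟨m, rfl⟩ := Nat.exists_eq_succ_of_ne_zero h0
  exact ⟨m, hn, rfl⟩

lemma eLpNorm_count_succ_le (q : ℝ≥0∞) (b : ℕ → ℝ≥0∞) :
    eLpNorm (fun n => b (n + 1)) q Measure.count ≤ eLpNorm b q Measure.count := by
  refine le_trans (le_of_eq ?_) (eLpNorm_mono_measure b map_succ_count_le)
  exact (eLpNorm_map_measure (measurable_of_countable _).aestronglyMeasurable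
    (measurable_of_countable _).aemeasurable).symm

/-- The triangle inequality peels off the term at index 0; the shift accounts for all the others. -/
lemma eLpNorm_count_le_add_succ {q : ℝ≥0∞} (hq : 1 ≤ q) (b : ℕ → ℝ≥0∞) :
    eLpNorm b q Measure.count ≤ b 0 + eLpNorm (fun n => b (n + 1)) q Measure.count := by
  have hq0 : q ≠ 0 := (zero_lt_one.trans_le hq).ne'
  have hb : b = ({0} : Set ℕ).indicator (fun _ => b 0) + ({0}ᶜ : Set ℕ).indicator b := by
    funext n
    rcases n with _ | n <;> simp
  calc eLpNorm b q Measure.count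
      ≤ eLpNorm (({0} : Set ℕ).indicator (fun _ => b 0)) q Measure.count +
          eLpNorm (({0}ᶜ : Set ℕ).indicator b) q Measure.count := by
        conv_lhs => rw [hb]
        exact eLpNorm_add_le (measurable_of_countable _).aestronglyMeasurable
          (measurable_of_countable _).aestronglyMeasurable hq
    _ ≤ _ := by
        gcongr
        · rw [eLpNorm_indicator_const' (measurableSet_singleton 0) (by simp) hq0]
          simp
        · rw [eLpNorm_indicator_eq_eLpNorm_restrict (measurableSet_singleton 0).compl]
          refine (eLpNorm_mono_measure b restrict_count_le_map_succ).trans_eq ?_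
          exact eLpNorm_map_measure (measurable_of_countable _).aestronglyMeasurable
            (measurable_of_countable _).aemeasurable

lemma eLpNorm_indicator_Icc (p : ℝ≥0∞) (h : ℝ≥0 → ℝ≥0∞) :
    eLpNorm ((Set.Icc 0 1).indicator h) p lam = eLpNorm h p (cell 0) := by
  rw [eLpNorm_indicator_eq_eLpNorm_restrict measurableSet_Icc, cell,
    ← Measure.restrict_congr_set (Ico_ae_eq_Icc (a := (0 : ℝ≥0)) (b := 1))]
  simp

/-- With equal exponents the Lebesgue norm is an amalgam norm (`amalgam_self`). The truncated
function vanishes on cell 0, so peeling off that cell loses nothing. -/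
lemma eLpNorm_indicator_Ioi {q : ℝ≥0∞} (hq : 1 ≤ q) (h : ℝ≥0 → ℝ≥0∞) :
    eLpNorm ((Set.Ioi 1).indicator h) q lam =
      eLpNorm (fun n : ℕ => eLpNorm h q (cell (n + 1))) q Measure.count := by
  rw [eLpNorm_indicator_eq_eLpNorm_restrict measurableSet_Ioi,
    Measure.restrict_congr_set (Ioi_ae_eq_Ici (a := (1 : ℝ≥0))),
    ← eLpNorm_indicator_eq_eLpNorm_restrict measurableSet_Ici, ← amalgam_self, amalgam]
  have h0 : eLpNorm ((Set.Ici 1).indicator h) q (cell 0) = 0 := by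
    refine (eLpNorm_congr_ae (g := 0) (ae_cell fun t _ ht => ?_)).trans eLpNorm_zero
    simpa using fun h1 : (1 : ℝ≥0) ≤ t => absurd ht (by simpa using h1)
  have hsucc (n : ℕ) : eLpNorm ((Set.Ici 1).indicator h) q (cell (n + 1)) =
      eLpNorm h q (cell (n + 1)) := by
    refine eLpNorm_congr_ae (ae_cell fun t ht _ => Set.indicator_of_mem ?_ h)
    exact le_trans (by simp) ht
  have hS := eLpNorm_count_le_add_succ hq fun n => eLpNorm ((Set.Ici 1).indicator h) q (cell n)
  simp only [h0, hsucc, zero_add] at hS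
  refine le_antisymm hS ?_
  have hS' := eLpNorm_count_succ_le q fun n => eLpNorm ((Set.Ici 1).indicator h) q (cell n)
  simpa only [hsucc] using hS'

/-- Replacing the local exponent `p` by `q` costs a shift by one cell, so cells 0 and 1 are both
charged to the `L^p` norm on cell 0; hence the factor 2. -/
lemma amalgam_le_of_antitone {h : ℝ≥0 → ℝ≥0∞} (hh : Antitone h) {p q : ℝ≥0∞} (hp : p ≠ 0)
    (hq : 1 ≤ q) :
    amalgam p q h ≤ 2 * (eLpNorm ((Set.Icc 0 1).indicator h) p lam +
      eLpNorm ((Set.Ioi 1).indicator h) q lam) := by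
  have hq0 : q ≠ 0 := (zero_lt_one.trans_le hq).ne'
  rw [eLpNorm_indicator_Icc, eLpNorm_indicator_Ioi hq]
  calc amalgam p q h
      ≤ eLpNorm h p (cell 0) +
          eLpNorm (fun n : ℕ => eLpNorm h p (cell (n + 1))) q Measure.count :=
        eLpNorm_count_le_add_succ hq _
    _ ≤ eLpNorm h p (cell 0) + (eLpNorm h p (cell (0 + 1)) +
          eLpNorm (fun n : ℕ => eLpNorm h p (cell (n + 1 + 1))) q Measure.count) := by
        gcongr
        exact eLpNorm_count_le_add_succ hq fun n => eLpNorm h p (cell (n + 1))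
    _ ≤ eLpNorm h p (cell 0) + (eLpNorm h p (cell 0) +
          eLpNorm (fun n : ℕ => eLpNorm h q (cell (n + 1))) q Measure.count) := by
        refine add_le_add_right (add_le_add (eLpNorm_cell_succ_le_of_antitone hh hp hp 0) ?_) _
        exact eLpNorm_mono_enorm fun n => eLpNorm_cell_succ_le_of_antitone hh hp hq0 (n + 1)
    _ ≤ _ := by
        rw [← add_assoc, ← two_mul, mul_add]
        gcongr
        exact le_mul_of_one_le_left' one_le_two

lemma le_amalgam_of_antitone {h : ℝ≥0 → ℝ≥0∞} (hh : Antitone h) {p q : ℝ≥0∞} (hp : p ≠ 0)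
    (hq : 1 ≤ q) :
    eLpNorm ((Set.Icc 0 1).indicator h) p lam + eLpNorm ((Set.Ioi 1).indicator h) q lam ≤
      2 * amalgam p q h := by
  have hq0 : q ≠ 0 := (zero_lt_one.trans_le hq).ne'
  rw [eLpNorm_indicator_Icc, eLpNorm_indicator_Ioi hq, two_mul]
  exact add_le_add (eLpNorm_cell_le_amalgam hq0 h 0)
    (eLpNorm_mono_enorm fun n => eLpNorm_cell_succ_le_of_antitone hh hq0 hp n)

/-- Functions of bounded support with values in `[0, 1]` have finite amalgam norm. -/
lemma amalgam_lt_top_of_le_one {h : ℝ≥0 → ℝ≥0∞} {p q : ℝ≥0∞} (hp : p ≠ 0)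
    (h1 : ∀ t, h t ≤ 1) {N : ℕ} (hN : ∀ t : ℝ≥0, N ≤ t → h t = 0) :
    amalgam p q h < ⊤ := by
  have hle (n : ℕ) : eLpNorm h p (cell n) ≤ (Set.Iio N).indicator (fun _ => (1 : ℝ≥0∞)) n := by
    by_cases hn : n < N
    · rw [Set.indicator_of_mem (Set.mem_Iio.2 hn)]
      exact (eLpNorm_mono_enorm h1).trans_eq (eLpNorm_cell_const p hp 1 n)
    · refine le_of_eq_of_le ?_ zero_le
      refine (eLpNorm_congr_ae (g := 0) (ae_cell fun t ht _ => ?_)).trans eLpNorm_zero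
      exact hN t (le_trans (mod_cast not_lt.1 hn) ht)
  refine lt_of_le_of_lt (eLpNorm_mono_enorm (g := (Set.Iio N).indicator fun _ => (1 : ℝ≥0∞)) hle)
    ((eLpNorm_indicator_const_le _ _).trans_lt ?_)
  rw [enorm_eq_self, one_mul]
  exact ENNReal.rpow_lt_top_of_nonneg (by positivity)
    (Measure.count_apply_lt_top.2 (Set.finite_Iio N)).ne

/-! ### Functions separating the exponents -/

/-- The union of the intervals `[n, n + e n)`, for `e n ≤ 1`. -/
def blocks (e : ℕ → ℝ≥0) : Set ℝ≥0 := {t | t < ⌊t⌋₊ + e ⌊t⌋₊}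

lemma measurableSet_blocks (e : ℕ → ℝ≥0) : MeasurableSet (blocks e) :=
  measurableSet_lt measurable_id
    ((measurable_of_countable fun n : ℕ => (n : ℝ≥0) + e n).comp Nat.measurable_floor)

/-- The step function with the value `c n` on `[n, n + e n)`. -/
noncomputable def blockFun (e c : ℕ → ℝ≥0) : ℝ≥0 → ℝ≥0∞ :=
  (blocks e).indicator fun t => c ⌊t⌋₊

lemma measurable_blockFun (e c : ℕ → ℝ≥0) : Measurable (blockFun e c) :=
  ((measurable_of_countable fun n : ℕ => (c n : ℝ≥0∞)).comp Nat.measurable_floor).indicator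
    (measurableSet_blocks e)

/-- For `p = ⊤` the exponent `1 / p.toReal` is 0 and the formula gives `c n`, which is correct
because the block has positive length. -/
lemma eLpNorm_blockFun {e : ℕ → ℝ≥0} (he0 : ∀ n, e n ≠ 0) (he1 : ∀ n, e n ≤ 1) (c : ℕ → ℝ≥0)
    {p : ℝ≥0∞} (hp : p ≠ 0) (n : ℕ) :
    eLpNorm (blockFun e c) p (cell n) = c n * (e n : ℝ≥0∞) ^ (1 / p.toReal) := by
  have hae : blockFun e c =ᵐ[cell n]
      (Set.Ico (n : ℝ≥0) (n + e n)).indicator fun _ => (c n : ℝ≥0∞) := by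
    refine ae_cell fun t h1 h2 => ?_
    have hfl : ⌊t⌋₊ = n := (Nat.floor_eq_iff zero_le).2 ⟨h1, h2⟩
    simp [blockFun, blocks, Set.indicator_apply, hfl, h1]
  have hmeas : cell n (Set.Ico (n : ℝ≥0) (n + e n)) = e n := by
    rw [cell, Measure.restrict_apply measurableSet_Ico, Set.inter_eq_left.2, lam_Ico,
      add_tsub_cancel_left]
    exact Set.Ico_subset_Ico_right (by gcongr; exact he1 n)
  rw [eLpNorm_congr_ae hae, eLpNorm_indicator_const' measurableSet_Ico
    (by simpa [hmeas] using he0 n) hp, hmeas, enorm_eq_self]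

/-- The power sequence `(n + 1) ^ s`. -/
noncomputable def powSeq (s : ℝ) (n : ℕ) : ℝ≥0 := ((n : ℝ≥0) + 1) ^ s

lemma powSeq_ne_zero (s : ℝ) (n : ℕ) : powSeq s n ≠ 0 :=
  (NNReal.rpow_pos (by positivity)).ne'

lemma powSeq_le_one {s : ℝ} (hs : s ≤ 0) (n : ℕ) : powSeq s n ≤ 1 :=
  NNReal.rpow_le_one_of_one_le_of_nonpos (by simp) hs

lemma powSeq_mul_rpow (s r x : ℝ) (n : ℕ) :
    (powSeq s n : ℝ≥0∞) * (powSeq r n : ℝ≥0∞) ^ x = powSeq (s + r * x) n := by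
  rw [← ENNReal.coe_rpow_of_ne_zero (powSeq_ne_zero r n), ← ENNReal.coe_mul]
  unfold powSeq
  rw [← NNReal.rpow_mul, ← NNReal.rpow_add (by positivity)]

lemma tsum_powSeq_ne_top_iff {s : ℝ} : ∑' n, (powSeq s n : ℝ≥0∞) ≠ ⊤ ↔ s < -1 := by
  rw [ENNReal.tsum_coe_ne_top_iff_summable, ← NNReal.summable_rpow,
    ← NNReal.summable_nat_add_iff (f := fun n : ℕ => (n : ℝ≥0) ^ s) 1]
  simp only [Nat.cast_add, Nat.cast_one]
  rfl

lemma eLpNorm_powSeq {s : ℝ} {q : ℝ≥0∞} (hq0 : q ≠ 0) (hq : q ≠ ⊤) :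
    eLpNorm (fun n => (powSeq s n : ℝ≥0∞)) q Measure.count =
      (∑' n, (powSeq (s * q.toReal) n : ℝ≥0∞)) ^ (1 / q.toReal) := by
  rw [eLpNorm_eq_lintegral_rpow_enorm_toReal hq0 hq, lintegral_count]
  simp only [enorm_eq_self]
  congr 2
  funext n
  simpa [powSeq] using powSeq_mul_rpow 0 s q.toReal n

lemma eLpNorm_powSeq_lt_top {s : ℝ} {q : ℝ≥0∞} (hq0 : q ≠ 0) (hs : s < -(1 / q.toReal)) :
    eLpNorm (fun n => (powSeq s n : ℝ≥0∞)) q Measure.count < ⊤ := by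
  rcases eq_or_ne q ⊤ with rfl | hq
  · rw [eLpNorm_exponent_top, eLpNormEssSup]
    simp only [enorm_eq_self, essSup_count]
    refine lt_of_le_of_lt (iSup_le fun n => ?_) ENNReal.one_lt_top
    exact_mod_cast powSeq_le_one (by simpa using hs.le) n
  have hr : 0 < q.toReal := ENNReal.toReal_pos hq0 hq
  rw [eLpNorm_powSeq hq0 hq]
  refine ENNReal.rpow_lt_top_of_nonneg (by positivity) (tsum_powSeq_ne_top_iff.2 ?_)
  rw [← neg_div, lt_div_iff₀ hr] at hs
  exact hs

lemma eLpNorm_powSeq_eq_top {s : ℝ} {q : ℝ≥0∞} (hq0 : q ≠ 0) (hq : q ≠ ⊤)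
    (hs : -(1 / q.toReal) ≤ s) :
    eLpNorm (fun n => (powSeq s n : ℝ≥0∞)) q Measure.count = ⊤ := by
  have hr : 0 < q.toReal := ENNReal.toReal_pos hq0 hq
  rw [eLpNorm_powSeq hq0 hq, ENNReal.rpow_eq_top_iff_of_pos (by positivity)]
  by_contra h
  rw [← ne_eq, tsum_powSeq_ne_top_iff] at h
  rw [← neg_div, div_le_iff₀ hr] at hs
  exact hs.not_gt h

/-- Since `(⊤).toReal = 0`, the real number `1 / p.toReal` is 0 at `p = ⊤`, the value wanted for
`1/∞`; passing to inverses in `ℝ≥0∞` makes the comparison uniform. -/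
lemma one_div_toReal_lt {p q : ℝ≥0∞} (hq : 1 ≤ q) (h : q < p) : 1 / p.toReal < 1 / q.toReal := by
  rw [one_div, one_div, ← ENNReal.toReal_inv, ← ENNReal.toReal_inv]
  exact ENNReal.toReal_strict_mono (ENNReal.inv_ne_top.2 (zero_lt_one.trans_le hq).ne')
    (ENNReal.inv_lt_inv.2 h)

lemma one_div_toReal_le_one {p : ℝ≥0∞} (hp : 1 ≤ p) : 1 / p.toReal ≤ 1 := by
  rw [one_div, ← ENNReal.toReal_inv]
  exact ENNReal.toReal_le_of_le_ofReal zero_le_one (by simpa using hp)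

lemma exists_one_lt_mul_lt {x y : ℝ} (hx : 0 ≤ x) (hxy : x < y) : ∃ r : ℝ, 1 < r ∧ r * x < y := by
  have h : 0 < y + x := by linarith
  -- The quotient of `y` by the midpoint of `x` and `y`: it exceeds 1 because the midpoint is below
  -- `y`, and multiplying by `x` gives less than `y` because `x` is below the midpoint.
  refine ⟨2 * y / (y + x), (one_lt_div h).2 (by linarith), ?_⟩
  rw [div_mul_eq_mul_div, div_lt_iff₀ h]
  nlinarith

lemma amalgam_blockFun_powSeq {p q : ℝ≥0∞} (hp : p ≠ 0) {r : ℝ} (hr : 0 ≤ r) (s : ℝ) :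
    amalgam p q (blockFun (powSeq (-r)) (powSeq s)) =
      eLpNorm (fun n => (powSeq (s + -r * (1 / p.toReal)) n : ℝ≥0∞)) q Measure.count := by
  unfold amalgam
  simp only [eLpNorm_blockFun (powSeq_ne_zero (-r)) (powSeq_le_one (neg_nonpos.2 hr)) _ hp,
    powSeq_mul_rpow]

lemma lintegral_blockFun_powSeq {r : ℝ} (hr : 0 ≤ r) (s : ℝ) :
    ∫⁻ t, blockFun (powSeq (-r)) (powSeq s) t ∂lam = ∑' n, (powSeq (s - r) n : ℝ≥0∞) := by
  rw [lintegral_lam_eq_tsum_eLpNorm]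
  simp only [eLpNorm_blockFun (powSeq_ne_zero (-r)) (powSeq_le_one (neg_nonpos.2 hr)) _ one_ne_zero,
    powSeq_mul_rpow, ENNReal.toReal_one, div_one, mul_one, sub_eq_add_neg]

lemma blockFun_powSeq_zero (e : ℕ → ℝ≥0) :
    blockFun e (powSeq 0) = (blocks e).indicator fun _ => 1 := by
  simp [blockFun, powSeq]

lemma lam_blocks_powSeq_lt_top {r : ℝ} (hr : 1 < r) : lam (blocks (powSeq (-r))) < ⊤ := by
  rw [← lintegral_indicator_one (measurableSet_blocks _)]
  have h := lintegral_blockFun_powSeq (zero_le_one.trans hr.le) 0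
  rw [blockFun_powSeq_zero] at h
  refine lt_of_eq_of_lt h (lt_top_iff_ne_top.2 (tsum_powSeq_ne_top_iff.2 (by linarith)))

/-- If `q < p`, then some set of finite measure has an indicator of infinite amalgam norm. -/
lemma exists_indicator_amalgam_eq_top {p q : ℝ≥0∞} (hq : 1 ≤ q) (h : q < p) :
    ∃ E : Set ℝ≥0, MeasurableSet E ∧ lam E < ⊤ ∧
      amalgam p q (E.indicator fun _ => 1) = ⊤ := by
  -- `r > 1` makes the total length `∑ (n+1)^(-r)` finite, while `r/p < 1/q` keeps the local norms
  -- `(n+1)^(-r/p)` out of `l^q`.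
  obtain ⟨r, hr, hrx⟩ := exists_one_lt_mul_lt (by positivity) (one_div_toReal_lt hq h)
  refine ⟨blocks (powSeq (-r)), measurableSet_blocks _, lam_blocks_powSeq_lt_top hr, ?_⟩
  have hq0 : q ≠ 0 := (zero_lt_one.trans_le hq).ne'
  rw [← blockFun_powSeq_zero, amalgam_blockFun_powSeq ((pos_of_ne_zero hq0).trans h).ne'
    (zero_le_one.trans hr.le)]
  exact eLpNorm_powSeq_eq_top hq0 h.ne_top (by linarith)

/-- If `p < q`, then some function of finite amalgam norm, supported in a set of finite measure,
is not integrable. -/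
lemma exists_amalgam_lt_top_lintegral_eq_top {p q : ℝ≥0∞} (hp : 1 ≤ p) (h : p < q) :
    ∃ (E : Set ℝ≥0) (g : ℝ≥0 → ℝ≥0∞), MeasurableSet E ∧ lam E < ⊤ ∧ Measurable g ∧
      (∀ t ∉ E, g t = 0) ∧ amalgam p q g < ⊤ ∧ ∫⁻ t, g t ∂lam = ⊤ := by
  have hp0 : p ≠ 0 := (zero_lt_one.trans_le hp).ne'
  -- Heights `(n+1)^(r-1)` on lengths `(n+1)^(-r)` turn the integral into the harmonic series. The
  -- local norms `(n+1)^(r-1-r/p)` lie in `l^q` because `r(1 - 1/p) < 1 - 1/q`.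
  obtain ⟨r, hr, hrx⟩ := exists_one_lt_mul_lt (sub_nonneg.2 (one_div_toReal_le_one hp))
    (sub_lt_sub_left (one_div_toReal_lt hp h) 1)
  have hr0 : 0 ≤ r := zero_le_one.trans hr.le
  refine ⟨blocks (powSeq (-r)), blockFun (powSeq (-r)) (powSeq (r - 1)), measurableSet_blocks _,
    lam_blocks_powSeq_lt_top hr, measurable_blockFun _ _,
    fun t ht => Set.indicator_of_notMem ht _, ?_, ?_⟩
  · rw [amalgam_blockFun_powSeq hp0 hr0]
    exact eLpNorm_powSeq_lt_top ((pos_of_ne_zero hp0).trans h).ne' (by linarith)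
  · rw [lintegral_blockFun_powSeq hr0]
    by_contra hne
    have := tsum_powSeq_ne_top_iff.1 hne
    linarith

/-! ### Norm axioms -/

/-- The rearrangement lives on `[0, N)` with `N > lam E`, so its infinite integral is a finite sum
of `L^1` norms over cells. On a cell, a probability space, the `L^1` norm is at most the `L^p` norm,
so some local `L^p` norm is infinite. -/
lemma amalgam_decreasing_eq_top {p q : ℝ≥0∞} (hp : 1 ≤ p) (hq : q ≠ 0) {E : Set ℝ≥0}
    {g : ℝ≥0 → ℝ≥0∞} (hE : lam E < ⊤) (hg : Measurable g) (hgE : ∀ t ∉ E, g t = 0)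
    (hint : ∫⁻ t, g t ∂lam = ⊤) : amalgam p q (decreasing g) = ⊤ := by
  by_contra hfin
  obtain ⟨N, hN⟩ := ENNReal.exists_nat_gt hE.ne
  have hd : ∫⁻ t, decreasing g t ∂lam = ∫⁻ t, g t ∂lam := by
    simpa only [eLpNorm_one_eq_lintegral_enorm, enorm_eq_self] using
      eLpNorm_decreasing hg.aemeasurable 1
  have hzero (n : ℕ) (hn : n ∉ Finset.range N) : eLpNorm (decreasing g) 1 (cell n) = 0 := by
    refine (eLpNorm_congr_ae (g := 0) (ae_cell fun t ht _ => ?_)).trans eLpNorm_zero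
    refine decreasing_eq_zero hgE (hN.le.trans ?_)
    have hNn : (N : ℝ≥0) ≤ n := mod_cast not_lt.1 fun h => hn (Finset.mem_range.2 h)
    exact_mod_cast hNn.trans ht
  rw [hint, lintegral_lam_eq_tsum_eLpNorm, tsum_eq_sum hzero] at hd
  refine ENNReal.sum_ne_top.2 (fun n _ => ne_top_of_le_ne_top hfin ?_) hd
  exact (eLpNorm_le_eLpNorm_of_exponent_le hp
    (measurable_decreasing g).aestronglyMeasurable).trans (eLpNorm_cell_le_amalgam hq _ n)

section

variable {p q : ℝ≥0∞}

lemma rearranged_wienerNorm (hq : q ≠ 0) (f : ℝ≥0 → ExtComplex) :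
    rearranged (wienerNorm p q) f = amalgam p q (decreasing (absFun f)) :=
  wienerNorm_lift hq _

lemma absInvariant_wienerNorm (hq : q ≠ 0) : AbsInvariant (wienerNorm p q) := fun f _ => by
  rw [wienerNorm_lift hq, wienerNorm_eq hq]

lemma axiomP1_wienerNorm (hp : 1 ≤ p) (hq : 1 ≤ q) : AxiomP1 (wienerNorm p q) := by
  have hp0 : p ≠ 0 := (zero_lt_one.trans_le hp).ne'
  have hq0 : q ≠ 0 := (zero_lt_one.trans_le hq).ne'
  refine ⟨fun a f _ => ?_, fun f hf => ?_, fun f g hf hg => ?_⟩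
  · rw [wienerNorm_eq hq0, wienerNorm_lift hq0, absFun_scale, amalgam_const_mul enorm_ne_top]
  · rw [wienerNorm_lift hq0, amalgam_eq_zero_iff hp0 hq0 hf]
  · simp only [wienerNorm_lift hq0]
    exact amalgam_add_le hp hq hf hg

lemma axiomP2_wienerNorm (hq : q ≠ 0) : AxiomP2 (wienerNorm p q) := fun f g _ _ h => by
  simpa only [wienerNorm_lift hq] using amalgam_mono h

lemma iSup_eq_of_monotone_tendsto {x : ℕ → ℝ≥0∞} {y : ℝ≥0∞}
    (h : Monotone x ∧ Tendsto x atTop (𝓝 y)) : Monotone x ∧ ⨆ n, x n = y :=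
  ⟨h.1, tendsto_nhds_unique (tendsto_atTop_iSup h.1) h.2⟩

lemma axiomP3_wienerNorm (hq : q ≠ 0) : AxiomP3 (wienerNorm p q) := fun F f hF _ h => by
  simp only [wienerNorm_lift hq]
  have h' : ∀ᵐ t ∂lam, Monotone (fun n => F n t) ∧ ⨆ n, F n t = f t :=
    h.mono fun t ht => iSup_eq_of_monotone_tendsto ht
  have hmono : Monotone fun n => amalgam p q (F n) := fun m n hmn =>
    amalgam_mono (h.mono fun t ht => ht.1 hmn)
  exact ⟨hmono, amalgam_iSup_of_monotone hF h' ▸ tendsto_atTop_iSup hmono⟩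

lemma axiomP3_rearranged_wienerNorm (hq : q ≠ 0) : AxiomP3 (rearranged (wienerNorm p q)) :=
    fun F f hF _ h => by
  simp only [rearranged_wienerNorm hq, absFun_lift]
  have h' : ∀ᵐ t ∂lam, Monotone (fun n => F n t) ∧ ⨆ n, F n t = f t :=
    h.mono fun t ht => iSup_eq_of_monotone_tendsto ht
  have hd : Monotone fun n => decreasing (F n) := fun m n hmn =>
    decreasing_mono (h.mono fun t ht => ht.1 hmn)
  have hmono : Monotone fun n => amalgam p q (decreasing (F n)) := fun m n hmn =>
    amalgam_mono (ae_of_all _ (hd hmn))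
  refine ⟨hmono, ?_⟩
  rw [← amalgam_iSup_of_monotone (fun n => (measurable_decreasing (F n)).aemeasurable)
    (ae_of_all _ fun t => ⟨fun m n hmn => hd hmn t, iSup_decreasing h' t⟩)]
  exact tendsto_atTop_iSup hmono

/-- Rearranging gathers a possibly spread-out set into an initial interval, which meets only
finitely many cells. -/
lemma amalgam_decreasing_indicator_lt_top (hp : p ≠ 0) {E : Set ℝ≥0} (hE : lam E < ⊤) :
    amalgam p q (decreasing (E.indicator fun _ => 1)) < ⊤ := by
  obtain ⟨N, hN⟩ := ENNReal.exists_nat_gt hE.ne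
  refine amalgam_lt_top_of_le_one hp (N := N) (fun t => ?_) fun t ht => ?_
  · refine decreasing_le (s := 1) ?_
    have hle (u : ℝ≥0) : E.indicator (fun _ => (1 : ℝ≥0∞)) u ≤ 1 :=
      Set.indicator_le_self' (fun _ _ => zero_le) u
    simp [(hle _).not_gt]
  · exact decreasing_eq_zero (fun u hu => Set.indicator_of_notMem hu _)
      (hN.le.trans (mod_cast ht))

/-- The functional `f ↦ ‖f*‖_{W(L^p, l^q)}` is a quasi-Banach function norm. -/
theorem isQuasiBanachFunctionNorm_rearranged_wienerNorm (hp : 1 ≤ p) (hq : 1 ≤ q) :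
    IsQuasiBanachFunctionNorm (rearranged (wienerNorm p q)) := by
  have hp0 : p ≠ 0 := (zero_lt_one.trans_le hp).ne'
  have hq0 : q ≠ 0 := (zero_lt_one.trans_le hq).ne'
  -- The quasi-triangle constant 4 is the dilation factor of `amalgam_comp_half_le`.
  refine ⟨fun f _ => ?_, ⟨fun a f _ => ?_, fun f hf => ?_, 4, by norm_num, fun f g hf hg => ?_⟩,
    fun f g _ _ h => ?_, axiomP3_rearranged_wienerNorm hq0, fun E _ hE => ?_⟩
  all_goals simp only [rearranged_wienerNorm hq0, absFun_lift]
  · rw [absFun_scale, enorm_eq_nnnorm, decreasing_const_mul, amalgam_const_mul ENNReal.coe_ne_top]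
  · rw [amalgam_eq_zero_iff hp0 hq0 (measurable_decreasing f).aemeasurable,
      decreasing_ae_eq_zero_iff]
  · have half (k : ℝ≥0 → ℝ≥0∞) : Measurable fun t => decreasing k (t / 2) :=
      (measurable_decreasing k).comp (by fun_prop)
    calc amalgam p q (decreasing fun t => f t + g t)
        ≤ amalgam p q (fun t => decreasing f (t / 2) + decreasing g (t / 2)) :=
          amalgam_mono (ae_of_all _ (decreasing_add_le f g))
      _ ≤ amalgam p q (fun t => decreasing f (t / 2)) + amalgam p q fun t => decreasing g (t / 2) :=
          amalgam_add_le hp hq (half f).aemeasurable (half g).aemeasurable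
      _ ≤ 4 * amalgam p q (decreasing f) + 4 * amalgam p q (decreasing g) :=
          add_le_add (amalgam_comp_half_le hp hq (measurable_decreasing f))
            (amalgam_comp_half_le hp hq (measurable_decreasing g))
      _ = _ := by rw [mul_add]; norm_cast
  · exact amalgam_mono (ae_of_all _ (decreasing_mono h))
  · exact amalgam_decreasing_indicator_lt_top hp0 hE

lemma rearrangementInvariant_rearranged (N : Functional) :
    RearrangementInvariant (rearranged N) := fun f g _ _ h => by
  simp only [rearranged, rearrangement_eq, decreasing_congr_lam h]

/-- The functional `f ↦ ‖f*‖_{W(L^p, l^q)}` is equivalent to the Wiener–Luxemburg quasinorm. -/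
theorem equivalentFunctionals_wienerLuxemburg (hp : p ≠ 0) (hq : 1 ≤ q) :
    EquivalentFunctionals (rearranged (wienerNorm p q))
      (wienerLuxemburg (lebesgueNorm p) (lebesgueNorm q)) := by
  refine ⟨2, two_pos, fun f _ => ?_⟩
  rw [rearranged_wienerNorm (zero_lt_one.trans_le hq).ne', wienerLuxemburg]
  simp only [lebesgueNorm, absFun_lift, rearrangement_eq]
  have hd := antitone_decreasing (absFun f)
  refine ⟨?_, le_amalgam_of_antitone hd hp hq⟩
  rw [mul_comm, ← div_eq_mul_inv]
  exact ENNReal.div_le_of_le_mul' (amalgam_le_of_antitone hd hp hq)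

/-! ### Failure of (P4) and (P5), and the Lebesgue case of equal exponents -/

theorem not_axiomP4_wienerNorm (hq : 1 ≤ q) (h : q < p) : ¬ AxiomP4 (wienerNorm p q) := fun h4 => by
  obtain ⟨E, hE, hfin, htop⟩ := exists_indicator_amalgam_eq_top hq h
  have := h4 E hE.nullMeasurableSet hfin
  rw [wienerNorm_lift (zero_lt_one.trans_le hq).ne', htop] at this
  exact this.ne rfl

theorem not_axiomP5_wienerNorm (hp : 1 ≤ p) (h : p < q) : ¬ AxiomP5 (wienerNorm p q) := fun h5 => by
  obtain ⟨E, g, hE, hfin, hg, hgE, hW, hint⟩ := exists_amalgam_lt_top_lintegral_eq_top hp h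
  obtain ⟨C, hC⟩ := h5 E hE.nullMeasurableSet hfin
  have hCg := hC g hg.aemeasurable
  rw [wienerNorm_lift (zero_lt_one.trans_le (hp.trans h.le)).ne',
    setLIntegral_eq_of_support_subset (Function.support_subset_iff'.2 hgE), hint] at hCg
  exact (ENNReal.mul_lt_top ENNReal.coe_lt_top hW).not_ge hCg

lemma wienerNorm_self (hp : p ≠ 0) (f : ℝ≥0 → ExtComplex) :
    wienerNorm p p f = lebesgueNorm p f := by
  rw [wienerNorm_eq hp, amalgam_self, lebesgueNorm]

theorem isBanachFunctionNorm_wienerNorm_self (hp : 1 ≤ p) :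
    IsBanachFunctionNorm (wienerNorm p p) := by
  have hp0 : p ≠ 0 := (zero_lt_one.trans_le hp).ne'
  refine ⟨absInvariant_wienerNorm hp0, axiomP1_wienerNorm hp hp, axiomP2_wienerNorm hp0,
    axiomP3_wienerNorm hp0, fun E _ hfin => ?_, fun E _ hfin => ?_⟩
  · rw [wienerNorm_lift hp0, amalgam_self]
    refine (eLpNorm_indicator_const_le _ _).trans_lt ?_
    rw [enorm_eq_self, one_mul]
    exact ENNReal.rpow_lt_top_of_nonneg (by positivity) hfin.ne
  · have hexp : 0 ≤ 1 / (1 : ℝ≥0∞).toReal - 1 / p.toReal := by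
      simpa using one_div_toReal_le_one hp
    -- Hölder's constant `lam E ^ (1 - 1/p)`.
    refine ⟨(lam E ^ (1 / (1 : ℝ≥0∞).toReal - 1 / p.toReal)).toNNReal, fun f hf => ?_⟩
    rw [ENNReal.coe_toNNReal (ENNReal.rpow_ne_top_of_nonneg hexp hfin.ne), wienerNorm_lift hp0,
      amalgam_self, mul_comm]
    have h := eLpNorm_le_eLpNorm_mul_rpow_measure_univ (f := f) (μ := lam.restrict E) hp
      (hf.mono_measure (Measure.restrict_le_self (s := E))).aestronglyMeasurable
    rw [eLpNorm_one_eq_lintegral_enorm, Measure.restrict_apply_univ] at h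
    simp only [enorm_eq_self] at h
    exact h.trans (mul_le_mul_left (eLpNorm_mono_measure f Measure.restrict_le_self) _)

lemma rearrangementInvariant_wienerNorm_self (hp : p ≠ 0) :
    RearrangementInvariant (wienerNorm p p) := fun f g hf hg h => by
  simp only [wienerNorm_self hp, lebesgueNorm]
  exact eLpNorm_eq_of_measure_lt_eq hf.aemeasurable_absFun hg.aemeasurable_absFun h p

theorem isBanachFunctionNorm_wienerNorm_iff (hp : 1 ≤ p) (hq : 1 ≤ q) :
    IsBanachFunctionNorm (wienerNorm p q) ↔ p = q := by
  refine ⟨fun h => ?_, fun h => h ▸ isBanachFunctionNorm_wienerNorm_self hp⟩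
  rcases lt_trichotomy p q with hlt | heq | hlt
  · exact absurd h.p5 (not_axiomP5_wienerNorm hp hlt)
  · exact heq
  · exact absurd h.p4 (not_axiomP4_wienerNorm hq hlt)

/-! ### Equivalence with rearrangement-invariant functionals -/

lemma EquivalentFunctionals.refl (N : Functional) : EquivalentFunctionals N N :=
  ⟨1, one_pos, fun _ _ => by simp⟩

lemma EquivalentFunctionals.eq_top_iff {N₁ N₂ : Functional} (h : EquivalentFunctionals N₁ N₂)
    {f : ℝ≥0 → ExtComplex} (hf : MemM f) : N₁ f = ⊤ ↔ N₂ f = ⊤ := by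
  obtain ⟨C, _, hC⟩ := h
  obtain ⟨h1, h2⟩ := hC f hf
  constructor <;> intro htop
  · rwa [htop, ENNReal.mul_top (ENNReal.inv_ne_zero.2 ENNReal.coe_ne_top), top_le_iff] at h1
  · rw [htop, top_le_iff] at h2
    by_contra hne
    exact ENNReal.mul_ne_top ENNReal.coe_ne_top hne h2

/-- A functional equivalent to a rearrangement-invariant one is finite at `f` exactly when it is
finite at the rearrangement of `f`. -/
lemma amalgam_decreasing_eq_top_iff (hq : q ≠ 0) {N : Functional} (hN : RearrangementInvariant N)
    (h : EquivalentFunctionals (wienerNorm p q) N) {g : ℝ≥0 → ℝ≥0∞} (hg : Measurable g) :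
    amalgam p q (decreasing g) = ⊤ ↔ amalgam p q g = ⊤ := by
  have hMg := memM_lift hg.aemeasurable
  have hMd := memM_lift (measurable_decreasing g).aemeasurable
  have heq : N (lift (decreasing g)) = N (lift g) := hN _ _ hMd hMg fun s => by
    simpa only [distribution, absFun_lift] using lam_lt_decreasing g s
  rw [← wienerNorm_lift hq, ← wienerNorm_lift hq, h.eq_top_iff hMd, h.eq_top_iff hMg, heq]

/-- A Wiener amalgam norm equivalent to a rearrangement-invariant functional has equal
exponents. -/
theorem eq_of_equivalentFunctionals_wienerNorm (hp : 1 ≤ p) (hq : 1 ≤ q) {N : Functional}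
    (hN : RearrangementInvariant N) (h : EquivalentFunctionals (wienerNorm p q) N) : p = q := by
  have hp0 : p ≠ 0 := (zero_lt_one.trans_le hp).ne'
  have hq0 : q ≠ 0 := (zero_lt_one.trans_le hq).ne'
  rcases lt_trichotomy p q with hlt | heq | hlt
  -- Here `g` has finite amalgam norm and its rearrangement infinite norm.
  · obtain ⟨E, g, hE, hfin, hg, hgE, hW, hint⟩ := exists_amalgam_lt_top_lintegral_eq_top hp hlt
    exact absurd ((amalgam_decreasing_eq_top_iff hq0 hN h hg).1
      (amalgam_decreasing_eq_top hp hq0 hfin hg hgE hint)) hW.ne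
  · exact heq
  -- Here the indicator has infinite amalgam norm and its rearrangement finite norm.
  · obtain ⟨E, hE, hfin, htop⟩ := exists_indicator_amalgam_eq_top hq hlt
    exact absurd ((amalgam_decreasing_eq_top_iff hq0 hN h (measurable_const.indicator hE)).2 htop)
      (amalgam_decreasing_indicator_lt_top hp0 hfin).ne

end

end WienerLuxemburg

theorem mainTheorem12 (p q : ℝ≥0∞) (hp : 1 ≤ p) (hq : 1 ≤ q) :
    -- `f ↦ ‖f*‖_{W(L^p, l^q)}` is an r.i. quasi-Banach function norm,
    (IsQuasiBanachFunctionNorm (rearranged (wienerNorm p q)) ∧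
      RearrangementInvariant (rearranged (wienerNorm p q))) ∧
    -- equivalent to the Wiener–Luxemburg quasinorm
    EquivalentFunctionals (rearranged (wienerNorm p q))
      (wienerLuxemburg (lebesgueNorm p) (lebesgueNorm q)) ∧
    -- failure of (P4) and (P5) for the Wiener norm
    (q < p → ¬ AxiomP4 (wienerNorm p q)) ∧
    (p < q → ¬ AxiomP5 (wienerNorm p q)) ∧
    (IsBanachFunctionNorm (wienerNorm p q) ↔ p = q) ∧
    -- equivalence to an r.i. norm, for norms in the sense of (P1) and for Banach function norms
    ((∃ N : Functional, AbsInvariant N ∧ AxiomP1 N ∧ RearrangementInvariant N ∧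
      EquivalentFunctionals (wienerNorm p q) N) ↔ p = q) ∧
    ((∃ N : Functional, IsBanachFunctionNorm N ∧ RearrangementInvariant N ∧
      EquivalentFunctionals (wienerNorm p q) N) ↔ p = q) ∧
    -- for `p = q` it is the Lebesgue norm
    (p = q → ∀ f : ℝ≥0 → ExtComplex, MemM f → wienerNorm p q f = lebesgueNorm p f) := by
  have hp0 : p ≠ 0 := (zero_lt_one.trans_le hp).ne'
  have hq0 : q ≠ 0 := (zero_lt_one.trans_le hq).ne'
  refine ⟨⟨isQuasiBanachFunctionNorm_rearranged_wienerNorm hp hq,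
    rearrangementInvariant_rearranged _⟩, equivalentFunctionals_wienerLuxemburg hp0 hq,
    not_axiomP4_wienerNorm hq, not_axiomP5_wienerNorm hp,
    isBanachFunctionNorm_wienerNorm_iff hp hq, ⟨?_, ?_⟩, ⟨?_, ?_⟩, ?_⟩
  · rintro ⟨N, _, _, hN, h⟩
    exact eq_of_equivalentFunctionals_wienerNorm hp hq hN h
  · rintro rfl
    exact ⟨_, absInvariant_wienerNorm hp0, axiomP1_wienerNorm hp hp,
      rearrangementInvariant_wienerNorm_self hp0, .refl _⟩
  · rintro ⟨N, _, hN, h⟩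
    exact eq_of_equivalentFunctionals_wienerNorm hp hq hN h
  · rintro rfl
    exact ⟨_, isBanachFunctionNorm_wienerNorm_self hp,
      rearrangementInvariant_wienerNorm_self hp0, .refl _⟩
  · rintro rfl f _
    exact wienerNorm_self hp0 f
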